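/- Let $(\Omega,\mathcal F,\mathbb P)$ be a probability space, let $Y:\Omega\to\mathbb R^n$ be a random vector with values (almost surely) in $\mathfrak U\subset\mathbb R^n$, and let $f:\mathbb R^n\to\mathbb R$ be measurable. Let $\mathcal S$ be a finite stratification of $\mathfrak U$, i.e. a finite family of pairwise disjoint measurable sets (strata) with union $\mathfrak U$, such that $p_S:=\mathbb P(Y\in S)>0$ for every $S\in\mathcal S$. For each $S\in\mathcal S$ let $Q_S$ be a random variable whose distribution is that of $f(Y)$ conditioned upon $Y\in S$, i.e. $\mathbb P(Q_S\in A)=\mathbb P(f(Y)\in A,\,Y\in S)/p_S$. Assume that $Q_S\in L^4$ for every $S\in\mathcal S$, and put $\sigma_S:=\sqrt{\operatorname{Var}(Q_S)}$, $\boldsymbol p:=(p_S)_{S\in\mathcal S}$, $\boldsymbol\sigma:=(\sigma_S)_{S\in\mathcal S}$. For $\alpha\in[0,1]$ define the variance constant, as a function of $\boldsymbol\sigma\in\mathbb R^{|\mathcal S|}$, by $$C_\alpha(\boldsymbol\sigma):=\langle\boldsymbol p,\boldsymbol\sigma\rangle\sum_{S\in\mathcal S}\frac{p_S\sigma_S^2}{\alpha\sigma_S+(1-\alpha)\langle\boldsymbol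 p,\boldsymbol\sigma\rangle}.$$ Suppose that $\alpha\in[0,1]$ is such that, for the standard deviations of the strata, $$\alpha\sigma_S+(1-\alpha)\langle\boldsymbol p,\boldsymbol\sigma\rangle\neq0\qquad\text{for all }S\in\mathcal S .$$ For every $N\in\mathbb N$ and $S\in\mathcal S$ let the number of samples $N_S\in\mathbb N$ be given by the hybrid allocation rule $$N_S^\alpha:=(1-\alpha)\,p_SN+\alpha\,\frac{p_S\sigma_S}{\sum_{T\in\mathcal S}p_T\sigma_T}\,N$$ up to integer rounding, i.e. $|N_S-N_S^\alpha|\le1$. Let $Q_S^{(1)},Q_S^{(2)},\dots$ be samples distributed as $Q_S$, with all the $Q_S^{(j)}$ ($S\in\mathcal S$, $j\ge1$) mutually independent, and let $\hat{\boldsymbol\sigma}:=(\hat\sigma_S)_{S\in\mathcal S}$ be the vector of empirical standard deviations $$\hat\sigma_S:=\Bigl(\frac1{N_S-1}\sum_{j=1}^{N_S}\bigl(Q_S^{(j)}-\overline Q_S\bigr)^2\Bigr)^{1/2},\qquad \overline Q_S:=\frac1{N_S}\sum_{j=1}^{N_S}Q_S^{(j)} .$$ Then $C_\alpha$ is differentiable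 at $\boldsymbol\sigma$ and, as $N\to\infty$, $$\sqrt N\,\bigl(C_\alpha(\hat{\boldsymbol\sigma})-C_\alpha(\boldsymbol\sigma)\bigr)\Rightarrow\mathcal N(0,\varsigma_\alpha^2),\qquad \varsigma_\alpha^2:=\langle\nabla C_\alpha(\boldsymbol\sigma),\Sigma_\alpha\nabla C_\alpha(\boldsymbol\sigma)\rangle\ge0$$ in distribution, where $\Sigma_\alpha:=\operatorname{diag}(\varsigma_{S,\alpha}^2:S\in\mathcal S)$ with $$\varsigma_{S,\alpha}^2:=\begin{cases}\dfrac{\sigma_S^2(\kappa_S-1)\langle\boldsymbol p,\boldsymbol\sigma\rangle}{4p_S\bigl((1-\alpha)\langle\boldsymbol p,\boldsymbol\sigma\rangle+\alpha\sigma_S\bigr)},&\sigma_S\neq0,\\[2mm]0,&\sigma_S=0,\end{cases}$$ and $\kappa_S:=\mathbb E\bigl[|Q_S-\mathbb E Q_S|^4\bigr]/\sigma_S^4$ is the kurtosis of $Q_S$. (For the finitely many $N$ for which some $N_S\le1$, the corresponding $\hat\sigma_S$ is taken to be $0$.) -/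

import Mathlib

open MeasureTheory ProbabilityTheory Filter

noncomputable section

/-- A family of sets `S i` is a stratification of the domain `U`: the strata are measurable,
pairwise disjoint, and their union is `U`. -/
structure IsStratification {E ι : Type*} [MeasurableSpace E] (U : Set E) (S : ι → Set E) :
    Prop where
  measurableSet : ∀ i, MeasurableSet (S i)
  disjoint : Pairwise fun i j => Disjoint (S i) (S j)
  iUnion_eq : ⋃ i, S i = U

/-- The distribution of `Q_S`: the law of `f(Y)` conditioned upon `Y ∈ S`,
i.e. `A ↦ ℙ(f(Y) ∈ A, Y ∈ S) / ℙ(Y ∈ S)`. -/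
def stratumLaw {Ω E : Type*} [MeasurableSpace Ω] (P : Measure Ω) (Y : Ω → E) (f : E → ℝ)
    (S : Set E) : Measure ℝ :=
  (cond P (Y ⁻¹' S)).map (fun ω => f (Y ω))

/-- The vector `p` of the sizes `p_S = ℙ(Y ∈ S)` of the strata. -/
def strataSize {Ω E ι : Type*} [MeasurableSpace Ω] (P : Measure Ω) (Y : Ω → E)
    (S : ι → Set E) : EuclideanSpace ℝ ι :=
  WithLp.toLp 2 fun i => P.real (Y ⁻¹' S i)

/-- The vector `σ` of the standard deviations `σ_S = √Var(Q_S)` of the strata. -/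
def strataSD {Ω E ι : Type*} [MeasurableSpace Ω] (P : Measure Ω) (Y : Ω → E) (f : E → ℝ)
    (S : ι → Set E) : EuclideanSpace ℝ ι :=
  WithLp.toLp 2 fun i => √(variance id (stratumLaw P Y f (S i)))

/-- The kurtosis `𝔼|X - 𝔼 X|⁴ / Var(X)²` of a real random variable with law `ν`. -/
def kurtosis (ν : Measure ℝ) : ℝ :=
  (∫ x, |x - ∫ y, y ∂ν| ^ 4 ∂ν) / √(variance id ν) ^ 4

/-- The sample mean of `x 0, …, x (n - 1)`. -/
def sampleMean (n : ℕ) (x : ℕ → ℝ) : ℝ :=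
  (1 / (n : ℝ)) * ∑ j ∈ Finset.range n, x j

/-- The empirical standard deviation of `x 0, …, x (n - 1)`, the square root of the unbiased
sample variance. -/
def sampleSD (n : ℕ) (x : ℕ → ℝ) : ℝ :=
  √((1 / ((n : ℝ) - 1)) * ∑ j ∈ Finset.range n, (x j - sampleMean n x) ^ 2)

section Hybrid

variable {ι : Type*} [Fintype ι]

/-- The hybrid allocation `N_S^α = (1 - α) N_S^prop + α N_S^opt` of `N` samples, as a real number,
where `N_S^prop = p_S N` and `N_S^opt = p_S σ_S N / ∑_T p_T σ_T`. -/
def hybridAllocation (α : ℝ) (p σ : EuclideanSpace ℝ ι) (N : ℝ) (i : ι) : ℝ :=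
  (1 - α) * (p i * N) + α * (p i * σ i / (∑ k, p k * σ k) * N)

/-- The variance constant
`C_α(σ) = ⟨p, σ⟩ ∑_S p_S σ_S² / (α σ_S + (1 - α) ⟨p, σ⟩)`. -/
def varianceConstant (α : ℝ) (p σ : EuclideanSpace ℝ ι) : ℝ :=
  inner ℝ p σ * ∑ i, p i * σ i ^ 2 / (α * σ i + (1 - α) * inner ℝ p σ)

/-- The asymptotic variance `ς_{S,α}²` of the empirical standard deviation of a stratum with
`κ` the vector of stratum kurtoses. -/
def stratumAsympVar (α : ℝ) (p σ : EuclideanSpace ℝ ι) (κ : ι → ℝ) (i : ι) : ℝ :=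
  open Classical in
  if σ i = 0 then 0
  else σ i ^ 2 * (κ i - 1) * inner ℝ p σ /
    (4 * p i * ((1 - α) * inner ℝ p σ + α * σ i))

open Classical in
/-- The asymptotic variance `ς_α² = ⟨∇C_α(σ), Σ_α ∇C_α(σ)⟩` of the empirical variance constant,
with `Σ_α = diag(ς_{S,α}²)`. -/
def asympVar (α : ℝ) (p σ : EuclideanSpace ℝ ι) (κ : ι → ℝ) : ℝ :=
  inner ℝ (gradient (varianceConstant α p) σ)
    (Matrix.toEuclideanLin (Matrix.diagonal (stratumAsympVar α p σ κ))
      (gradient (varianceConstant α p) σ))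

end Hybrid

end

open scoped Topology NNReal ENNReal

section Convergence

variable {Ω Ω' ι : Type*} {mΩ : MeasurableSpace Ω} {mΩ' : MeasurableSpace Ω'}
  {P : Measure Ω} {P' : Measure Ω'} {l : Filter ι}

theorem tendstoInMeasure_add {E : Type*} [SeminormedAddCommGroup E] {f g : ι → Ω → E}
    {f' g' : Ω → E} (hf : TendstoInMeasure P f l f') (hg : TendstoInMeasure P g l g') :
    TendstoInMeasure P (fun i ω => f i ω + g i ω) l (fun ω => f' ω + g' ω) := by
  rw [tendstoInMeasure_iff_norm] at *
  intro ε hε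
  have h := (hf (ε / 2) (by positivity)).add (hg (ε / 2) (by positivity))
  rw [add_zero] at h
  refine tendsto_of_tendsto_of_tendsto_of_le_of_le tendsto_const_nhds h (fun _ => zero_le)
    fun i => (measure_mono ?_).trans (measure_union_le _ _)
  intro ω hω
  by_contra hcon
  simp only [Set.mem_union, Set.mem_ofPred_eq, not_or, not_le] at hcon hω
  have : ‖f i ω + g i ω - (f' ω + g' ω)‖ ≤ ‖f i ω - f' ω‖ + ‖g i ω - g' ω‖ := by
    rw [add_sub_add_comm]; exact norm_add_le _ _
  linarith

theorem tendstoInMeasure_finsetSum_zero {κ E : Type*} [SeminormedAddCommGroup E] (s : Finset κ)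
    {f : κ → ι → Ω → E} (hf : ∀ k ∈ s, TendstoInMeasure P (f k) l 0) :
    TendstoInMeasure P (fun i ω => ∑ k ∈ s, f k i ω) l 0 := by
  classical
  induction s using Finset.induction with
  | empty =>
    rw [tendstoInMeasure_iff_norm]
    intro ε hε
    simp [hε.not_ge, tendsto_const_nhds]
  | insert a s ha ih =>
    have h := tendstoInMeasure_add (hf a (Finset.mem_insert_self a s))
      (ih fun k hk => hf k (Finset.mem_insert_of_mem hk))
    simp only [Finset.sum_insert ha]
    refine h.congr_right (ae_of_all _ fun ω => ?_)
    simp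

theorem tendstoInMeasure_zero_of_norm_le {E F : Type*} [SeminormedAddCommGroup E]
    [SeminormedAddCommGroup F] {f : ι → Ω → E} {g : ι → Ω → F}
    (hg : TendstoInMeasure P g l 0) (hfg : ∀ i ω, ‖f i ω‖ ≤ ‖g i ω‖) :
    TendstoInMeasure P f l 0 := by
  rw [tendstoInMeasure_iff_norm] at *
  intro ε hε
  refine tendsto_of_tendsto_of_tendsto_of_le_of_le tendsto_const_nhds (hg ε hε)
    (fun _ => zero_le) fun i => measure_mono fun ω hω => ?_
  simp only [Set.mem_ofPred_eq, Pi.zero_apply, sub_zero] at hω ⊢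
  exact hω.trans (hfg i ω)

variable [IsProbabilityMeasure P] [IsProbabilityMeasure P']

theorem MeasureTheory.TendstoInDistribution.tendstoInMeasure_const {E : Type*} [SeminormedAddCommGroup E]
    [MeasurableSpace E] [BorelSpace E] {X : ι → Ω → E} {c : E}
    (h : TendstoInDistribution X l (fun _ => c) (fun _ => P) P') :
    TendstoInMeasure P X l (fun _ => c) := by
  rw [tendstoInMeasure_iff_norm]
  intro ε hε
  have hcl : IsClosed {x : E | ε ≤ ‖x - c‖} := isClosed_le (by fun_prop) (by fun_prop)
  have hlim := ProbabilityMeasure.limsup_measure_closed_le_of_tendsto h.tendsto hcl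
  have h0 : P'.map (fun _ => c) {x : E | ε ≤ ‖x - c‖} = 0 := by
    rw [Measure.map_apply (by fun_prop) hcl.measurableSet]
    simp [hε.not_ge]
  simp only [ProbabilityMeasure.coe_mk, h0] at hlim
  have h2 : ∀ i, P.map (X i) {x : E | ε ≤ ‖x - c‖} = P {ω | ε ≤ ‖X i ω - c‖} := fun i => by
    rw [Measure.map_apply_of_aemeasurable (h.forall_aemeasurable i) hcl.measurableSet]; rfl
  simp only [h2] at hlim
  exact tendsto_of_le_liminf_of_limsup_le (by simp) hlim

theorem MeasureTheory.TendstoInDistribution.mul_tendstoInMeasure_zero [l.IsCountablyGenerated]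
    {X Y : ι → Ω → ℝ} {Z : Ω' → ℝ}
    (hX : TendstoInDistribution X l Z (fun _ => P) P') (hY : TendstoInMeasure P Y l 0)
    (hYm : ∀ i, AEMeasurable (Y i) P) :
    TendstoInMeasure P (fun i ω => X i ω * Y i ω) l 0 := by
  have h := hX.continuous_comp_prodMk_of_tendstoInMeasure_const
    (g := fun x : ℝ × ℝ => x.1 * x.2) (c := 0) (by fun_prop) hY hYm
  simp only [mul_zero] at h
  exact TendstoInDistribution.tendstoInMeasure_const h

theorem MeasureTheory.TendstoInDistribution.congr_eventually [l.IsCountablyGenerated]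
    {X Y : ι → Ω → ℝ} {Z : Ω' → ℝ}
    (hX : TendstoInDistribution X l Z (fun _ => P) P') (hXY : ∀ᶠ i in l, X i =ᵐ[P] Y i)
    (hY : ∀ i, AEMeasurable (Y i) P) :
    TendstoInDistribution Y l Z (fun _ => P) P' := by
  refine tendstoInDistribution_of_tendstoInMeasure_sub (X := X) Y Z hX ?_ hY
  have h0 : TendstoInMeasure P (fun (_ : ι) (_ : Ω) => (0 : ℝ)) l 0 :=
    tendstoInMeasure_finsetSum_zero (∅ : Finset ι) (f := fun _ _ _ => (0 : ℝ)) (by simp)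
  refine h0.congr' ?_ EventuallyEq.rfl
  filter_upwards [hXY] with i hi
  filter_upwards [hi] with ω hω
  simp [hω]

theorem MeasureTheory.TendstoInDistribution.of_hasLaw {E : Type*} [TopologicalSpace E] [MeasurableSpace E]
    [OpensMeasurableSpace E] {X : ι → Ω → E} {Z : Ω' → E} {ν : Measure E} [IsProbabilityMeasure ν]
    (hX : TendstoInDistribution X l Z (fun _ => P) P') (hZ : HasLaw Z ν P') :
    TendstoInDistribution X l id (fun _ => P) ν where
  forall_aemeasurable := hX.forall_aemeasurable
  tendsto := by
    have h := hX.tendsto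
    convert h using 2
    ext1
    simp [hZ.map_eq]

theorem MeasureTheory.TendstoInDistribution.comp_tendsto {κ E : Type*} [TopologicalSpace E] [MeasurableSpace E]
    [OpensMeasurableSpace E] {X : ι → Ω → E} {Z : Ω' → E} {l' : Filter κ} {u : κ → ι}
    (hX : TendstoInDistribution X l Z (fun _ => P) P') (hu : Tendsto u l' l) :
    TendstoInDistribution (fun k => X (u k)) l' Z (fun _ => P) P' where
  forall_aemeasurable k := hX.forall_aemeasurable (u k)
  aemeasurable_limit := hX.aemeasurable_limit
  tendsto := hX.tendsto.comp hu

theorem MeasureTheory.TendstoInDistribution.gaussianReal_mul [l.IsCountablyGenerated]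
    {X Y : ι → Ω → ℝ} {v : ℝ} (hv : 0 ≤ v)
    (hX : TendstoInDistribution X l id (fun _ => P) (gaussianReal 0 v.toNNReal)) {c : ℝ}
    (hY : TendstoInMeasure P Y l (fun _ => c)) (hYm : ∀ i, AEMeasurable (Y i) P) :
    TendstoInDistribution (fun i ω => X i ω * Y i ω) l id (fun _ => P)
      (gaussianReal 0 (c ^ 2 * v).toNNReal) := by
  have h := hX.continuous_comp_prodMk_of_tendstoInMeasure_const
    (g := fun x : ℝ × ℝ => x.1 * x.2) (by fun_prop) hY hYm
  refine h.of_hasLaw ?_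
  have h2 := gaussianReal_mul_const (HasLaw.id (μ := gaussianReal 0 v.toNNReal)) c
  convert h2 using 2
  · simp
  · ext
    simp [hv, mul_nonneg (sq_nonneg c) hv]

end Convergence

section Independence

variable {Ω ι κ : Type*} {mΩ : MeasurableSpace Ω} {P : Measure Ω}

theorem iIndepFun_curry [Countable ι] [Countable κ] {E : Type*} [MeasurableSpace E]
    {X : ι → κ → Ω → E} (hX : ∀ i j, AEMeasurable (X i j) P)
    (h : iIndepFun (fun k : ι × κ => X k.1 k.2) P) :
    iIndepFun (fun i ω j => X i j ω) P := by
  have := h.isProbabilityMeasure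
  have hpr : ∀ i j, IsProbabilityMeasure (P.map (X i j)) :=
    fun i j => Measure.isProbabilityMeasure_map (hX i j)
  have hrow : ∀ i, iIndepFun (X i) P := fun i =>
    h.precomp (g := fun j => (i, j)) fun a b hab => by simpa using hab
  have hm : ∀ i, AEMeasurable (fun ω j => X i j ω) P := fun i => aemeasurable_pi_iff.2 (hX i)
  rw [iIndepFun_iff_map_fun_eq_infinitePi_map₀' hm]
  have hjoint : AEMeasurable (fun ω (k : ι × κ) => X k.1 k.2 ω) P :=
    aemeasurable_pi_iff.2 fun k => hX k.1 k.2
  have h1 := h.map_fun_eq_infinitePi_map₀ hjoint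
  have h2 := congrArg (Measure.map (MeasurableEquiv.curry ι κ E)) h1
  rw [Measure.infinitePi_map_curry (fun i j => P.map (X i j)),
    AEMeasurable.map_map_of_aemeasurable (by fun_prop) hjoint] at h2
  simp_rw [fun i => (hrow i).map_fun_eq_infinitePi_map₀' (hX i)]
  exact h2

theorem tendstoInDistribution_sum_gaussianReal [Fintype ι] [IsProbabilityMeasure P]
    {X : ι → ℕ → Ω → ℝ} {v : ι → ℝ} (hv : ∀ i, 0 ≤ v i)
    (hX : ∀ i, TendstoInDistribution (X i) atTop id (fun _ => P) (gaussianReal 0 (v i).toNNReal))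
    (hindep : ∀ n, iIndepFun (fun i => X i n) P) :
    TendstoInDistribution (fun n ω => ∑ i, X i n ω) atTop id (fun _ => P)
      (gaussianReal 0 (∑ i, v i).toNNReal) where
  forall_aemeasurable n :=
    Finset.aemeasurable_fun_sum _ fun i _ => (hX i).forall_aemeasurable n
  tendsto := by
    refine ProbabilityMeasure.tendsto_iff_tendsto_charFun.2 fun t => ?_
    have h := tendsto_finsetProd Finset.univ fun i _ =>
      ProbabilityMeasure.tendsto_iff_tendsto_charFun.1 (hX i).tendsto t
    simp only [ProbabilityMeasure.coe_mk, Measure.map_id, charFun_gaussianReal,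
      ← Complex.exp_sum] at h ⊢
    simp_rw [fun n => (hindep n).charFun_map_fun_sum_eq_prod
      fun i => (hX i).forall_aemeasurable n, Finset.prod_apply]
    convert h using 3
    simp [hv, Finset.sum_nonneg, Finset.sum_mul, Finset.sum_div]

end Independence

section SampleSD

theorem sum_sub_sampleMean_sq (n : ℕ) (x : ℕ → ℝ) (c : ℝ) :
    ∑ j ∈ Finset.range n, (x j - sampleMean n x) ^ 2
      = ∑ j ∈ Finset.range n, (x j - c) ^ 2 - n * (sampleMean n x - c) ^ 2 := by
  rcases Nat.eq_zero_or_pos n with rfl | hn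
  · simp
  have hn' : (n : ℝ) ≠ 0 := by positivity
  have hs : ∑ j ∈ Finset.range n, x j = n * sampleMean n x := by
    simp only [sampleMean]; field_simp
  have h : ∀ j, (x j - sampleMean n x) ^ 2
      = (x j - c) ^ 2 - 2 * (sampleMean n x - c) * x j + (sampleMean n x ^ 2 - c ^ 2) :=
    fun j => by ring
  simp only [h, Finset.sum_add_distrib, Finset.sum_sub_distrib, ← Finset.mul_sum, hs,
    Finset.sum_const, Finset.card_range, nsmul_eq_mul]
  ring

/-- The unbiased sample variance in terms of the deviations from an arbitrary centre. -/
theorem sampleSD_sq (n : ℕ) (x : ℕ → ℝ) (c : ℝ) :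
    sampleSD n x ^ 2 = (n / ((n : ℝ) - 1)) *
      ((∑ j ∈ Finset.range n, (x j - c) ^ 2) / n - (sampleMean n x - c) ^ 2) := by
  have hnn : 0 ≤ (1 / ((n : ℝ) - 1)) * ∑ j ∈ Finset.range n, (x j - sampleMean n x) ^ 2 := by
    rcases Nat.eq_zero_or_pos n with rfl | hn
    · simp
    have : (1 : ℝ) ≤ n := by exact_mod_cast hn
    have h1 : 0 ≤ (n : ℝ) - 1 := by linarith
    exact mul_nonneg (by positivity) (Finset.sum_nonneg fun j _ => sq_nonneg _)
  rw [sampleSD, Real.sq_sqrt hnn, sum_sub_sampleMean_sq n x c]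
  rcases Nat.eq_zero_or_pos n with rfl | hn
  · simp
  have hn' : (n : ℝ) ≠ 0 := by positivity
  rw [mul_sub, mul_sub, div_mul_div_comm, mul_comm ((n : ℝ) - 1), mul_div_mul_left _ _ hn']
  ring

theorem measurable_sampleMean (n : ℕ) : Measurable (sampleMean n) := by
  unfold sampleMean; fun_prop

theorem measurable_sampleSD (n : ℕ) : Measurable (sampleSD n) := by
  have := measurable_sampleMean n
  unfold sampleSD; fun_prop

theorem tendsto_natCast_div_sub_one :
    Tendsto (fun n : ℕ => (n : ℝ) / ((n : ℝ) - 1)) atTop (𝓝 1) := by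
  have h : Tendsto (fun n : ℕ => 1 + ((n : ℝ) - 1)⁻¹) atTop (𝓝 (1 + 0)) :=
    tendsto_const_nhds.add (tendsto_inv_atTop_zero.comp
      (tendsto_atTop_add_const_right _ (-1) tendsto_natCast_atTop_atTop))
  rw [add_zero] at h
  refine h.congr' ?_
  filter_upwards [eventually_gt_atTop 1] with n hn
  have : (1 : ℝ) < n := by exact_mod_cast hn
  have h1 : (n : ℝ) - 1 ≠ 0 := by linarith
  field_simp
  ring

theorem tendsto_sqrt_mul_natCast_div_sub_one_sub_one :
    Tendsto (fun n : ℕ => √(n : ℝ) * ((n : ℝ) / ((n : ℝ) - 1) - 1)) atTop (𝓝 0) := by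
  have h : Tendsto (fun n : ℕ => ((n : ℝ) / ((n : ℝ) - 1)) * (√(n : ℝ))⁻¹) atTop (𝓝 (1 * 0)) :=
    tendsto_natCast_div_sub_one.mul (tendsto_inv_atTop_zero.comp
      (Real.tendsto_sqrt_atTop.comp tendsto_natCast_atTop_atTop))
  rw [mul_zero] at h
  refine h.congr' ?_
  filter_upwards [eventually_gt_atTop 1] with n hn
  have : (1 : ℝ) < n := by exact_mod_cast hn
  have h1 : (n : ℝ) - 1 ≠ 0 := by linarith
  have h2 : √(n : ℝ) ≠ 0 := by positivity
  have h3 : (n : ℝ) = √(n : ℝ) ^ 2 := (Real.sq_sqrt (by positivity)).symm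
  have h4 : (n : ℝ) / ((n : ℝ) - 1) - 1 = 1 / ((n : ℝ) - 1) := by field_simp; ring
  rw [h4, div_mul_eq_mul_div, mul_one_div]
  congr 1
  nth_rewrite 1 [h3]
  field_simp

/-- The error of the sample standard deviation in terms of the centred sums. -/
theorem sqrt_mul_sampleSD_sub (n : ℕ) (x : ℕ → ℝ) (c : ℝ) {σ : ℝ} (hσ : 0 < σ) :
    √(n : ℝ) * (sampleSD n x - σ)
      = ((√(n : ℝ))⁻¹ * (∑ j ∈ Finset.range n, (x j - c) ^ 2 - n * σ ^ 2))
          * ((n / ((n : ℝ) - 1)) / (sampleSD n x + σ))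
        + (((√(n : ℝ))⁻¹ * (∑ j ∈ Finset.range n, x j - n * c))
            * (-((n / ((n : ℝ) - 1)) * (sampleMean n x - c) / (sampleSD n x + σ)))
          + √(n : ℝ) * ((n : ℝ) / ((n : ℝ) - 1) - 1) * (σ ^ 2 / (sampleSD n x + σ))) := by
  have hs : sampleSD n x + σ ≠ 0 := by
    have : 0 ≤ sampleSD n x := Real.sqrt_nonneg _
    positivity
  have h := sampleSD_sq n x c
  rcases Nat.eq_zero_or_pos n with rfl | hn
  · simp
  have hn' : (n : ℝ) ≠ 0 := by positivity
  have hr : √(n : ℝ) ≠ 0 := by positivity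
  have hrr : √(n : ℝ) ^ 2 = n := Real.sq_sqrt (by positivity)
  have e1 : (√(n : ℝ))⁻¹ * (∑ j ∈ Finset.range n, (x j - c) ^ 2 - n * σ ^ 2)
      = √(n : ℝ) * ((∑ j ∈ Finset.range n, (x j - c) ^ 2) / n - σ ^ 2) := by
    field_simp; rw [hrr]
  have e2 : (√(n : ℝ))⁻¹ * (∑ j ∈ Finset.range n, x j - n * c)
      = √(n : ℝ) * (sampleMean n x - c) := by
    unfold sampleMean; field_simp; rw [hrr]
  rw [e1, e2]
  have h5 : sampleSD n x - σ = (sampleSD n x ^ 2 - σ ^ 2) / (sampleSD n x + σ) := by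
    field_simp; ring
  rw [h5, h]
  ring

variable {Ω : Type*} {mΩ : MeasurableSpace Ω} {P : Measure Ω}
  {X : ℕ → Ω → ℝ}

theorem tendsto_sampleMean (hX : Integrable (X 0) P) (hindep : iIndepFun X P)
    (hident : ∀ j, IdentDistrib (X j) (X 0) P P) :
    ∀ᵐ ω ∂P, Tendsto (fun n => sampleMean n fun j => X j ω) atTop (𝓝 P[X 0]) := by
  filter_upwards [strong_law_ae_real X hX (fun i j hij => hindep.indepFun hij) hident] with ω hω
  refine hω.congr fun n => ?_
  rw [sampleMean, one_div_mul_eq_div]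

theorem iIndepFun_sub_sq (hindep : iIndepFun X P) (c : ℝ) :
    iIndepFun (fun j ω => (X j ω - c) ^ 2) P :=
  hindep.comp (fun _ x => (x - c) ^ 2) fun _ => by fun_prop

theorem identDistrib_sub_sq {Y Z : Ω → ℝ} (h : IdentDistrib Y Z P P) (c : ℝ) :
    IdentDistrib (fun ω => (Y ω - c) ^ 2) (fun ω => (Z ω - c) ^ 2) P P :=
  h.comp (u := fun x => (x - c) ^ 2) (by fun_prop)

variable [IsProbabilityMeasure P]

theorem memLp_two_sub_sq {Y : Ω → ℝ} (hY : MemLp Y 4 P) (c : ℝ) :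
    MemLp (fun ω => (Y ω - c) ^ 2) 2 P := by
  have h : MemLp (fun ω => Y ω - c) 4 P := hY.sub (memLp_const c)
  have : ENNReal.HolderTriple 4 4 2 := ⟨by
    rw [← two_mul, show (4 : ℝ≥0∞) = 2 * 2 by norm_num,
      ENNReal.mul_inv (by simp) (by simp), ← mul_assoc,
      ENNReal.mul_inv_cancel (by simp) (by simp), one_mul]⟩
  simpa only [sq] using h.mul' (r := 2) h

theorem variance_sub_integral_sq {Y : Ω → ℝ} (hY : MemLp Y 4 P) :
    Var[fun ω => (Y ω - P[Y]) ^ 2; P] = (∫ ω, |Y ω - P[Y]| ^ 4 ∂P) - Var[Y; P] ^ 2 := by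
  rw [variance_eq_sub (memLp_two_sub_sq hY _), variance_eq_integral hY.1.aemeasurable]
  congr 1
  refine integral_congr_ae (ae_of_all _ fun ω => ?_)
  simp only [Pi.pow_apply]
  rw [← abs_pow, abs_of_nonneg (by positivity)]
  ring

theorem tendsto_sampleSD (hX : MemLp (X 0) 2 P) (hindep : iIndepFun X P)
    (hident : ∀ j, IdentDistrib (X j) (X 0) P P) :
    ∀ᵐ ω ∂P, Tendsto (fun n => sampleSD n fun j => X j ω) atTop (𝓝 √Var[X 0; P]) := by
  have hsq : Integrable (fun ω => (X 0 ω - P[X 0]) ^ 2) P :=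
    (hX.sub (memLp_const _)).integrable_sq
  have h2 := strong_law_ae_real (fun j ω => (X j ω - P[X 0]) ^ 2) hsq
    (fun i j hij => (iIndepFun_sub_sq hindep _).indepFun hij)
    (fun j => identDistrib_sub_sq (hident j) _)
  filter_upwards [h2, tendsto_sampleMean (hX.integrable one_le_two) hindep hident] with ω h2 h1
  have h3 : Tendsto (fun n => √(sampleSD n (fun j => X j ω) ^ 2)) atTop (𝓝 √Var[X 0; P]) := by
    refine (Real.continuous_sqrt.tendsto _).comp ?_
    simp_rw [fun n => sampleSD_sq n (fun j => X j ω) P[X 0]]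
    convert tendsto_natCast_div_sub_one.mul
      (h2.sub ((h1.sub (tendsto_const_nhds (x := P[X 0]))).pow 2)) using 2
    rw [variance_eq_integral hX.1.aemeasurable]
    ring
  refine h3.congr fun n => ?_
  exact Real.sqrt_sq (Real.sqrt_nonneg _)

end SampleSD

section SampleSDCLT

variable {Ω : Type*} {mΩ : MeasurableSpace Ω} {P : Measure Ω} [IsProbabilityMeasure P]
  {X : ℕ → Ω → ℝ}

theorem sampleSD_ae_eq_zero (hX : MemLp (X 0) 2 P)
    (hident : ∀ j, IdentDistrib (X j) (X 0) P P) (hvar : Var[X 0; P] = 0) :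
    ∀ᵐ ω ∂P, ∀ n, sampleSD n (fun j => X j ω) = 0 := by
  have hae : ∀ᵐ ω ∂P, ∀ j, X j ω = P[X 0] := by
    refine ae_all_iff.2 fun j => ?_
    have hv : Var[X j; P] = 0 := by rw [(hident j).variance_eq, hvar]
    have := ae_eq_integral_of_variance_eq_zero ((hident j).memLp_iff.2 hX) hv
    rwa [(hident j).integral_eq] at this
  filter_upwards [hae] with ω hω n
  have h : sampleSD n (fun j => X j ω) ^ 2 = 0 := by
    rw [sampleSD_sq n _ P[X 0]]
    rcases Nat.eq_zero_or_pos n with rfl | hn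
    · simp
    have hn' : (n : ℝ) ≠ 0 := by positivity
    simp [hω, sampleMean, hn']
  rwa [pow_eq_zero_iff two_ne_zero] at h

/-- The central limit theorem for the sample standard deviation, for positive variance. -/
theorem tendstoInDistribution_sampleSD_of_pos (hX : MemLp (X 0) 4 P) (hindep : iIndepFun X P)
    (hident : ∀ j, IdentDistrib (X j) (X 0) P P) {c σ w : ℝ} (hc : P[X 0] = c) (hσ : 0 < σ)
    (hσX : Var[X 0; P] = σ ^ 2) (hw : Var[fun ω => (X 0 ω - c) ^ 2; P] = w) :
    TendstoInDistribution
      (fun (n : ℕ) ω => √(n : ℝ) * (sampleSD n (fun j => X j ω) - σ)) atTop id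
      (fun _ => P) (gaussianReal 0 (w / (4 * σ ^ 2)).toNNReal) := by
  have mX : ∀ j, AEMeasurable (X j) P := fun j => (hident j).aemeasurable_fst
  have hX2 : MemLp (X 0) 2 P := hX.mono_exponent (by norm_num)
  have mrow : AEMeasurable (fun ω j => X j ω) P := aemeasurable_pi_iff.2 mX
  have mSD : ∀ n, AEMeasurable (fun ω => sampleSD n fun j => X j ω) P := fun n =>
    (measurable_sampleSD n).comp_aemeasurable mrow
  have mMean : ∀ n, AEMeasurable (fun ω => sampleMean n fun j => X j ω) P := fun n =>
    (measurable_sampleMean n).comp_aemeasurable mrow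
  have hw0 : 0 ≤ w := hw ▸ variance_nonneg _ _
  have h2 := tendstoInDistribution_inv_sqrt_mul_sum_sub (P := P)
    (X := fun j ω => (X j ω - c) ^ 2) (Y := id) (P' := gaussianReal 0 w.toNNReal)
    (by rw [hw]; exact HasLaw.id) (memLp_two_sub_sq hX c)
    (iIndepFun_sub_sq hindep _) (fun j => identDistrib_sub_sq (hident j) _)
  have hv : ∫ ω, (X 0 ω - c) ^ 2 ∂P = σ ^ 2 := by
    rw [← hσX, variance_eq_integral (mX 0), hc]
  have h1 := tendstoInDistribution_inv_sqrt_mul_sum_sub (P := P) (X := X) (Y := id)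
    (P' := gaussianReal 0 Var[X 0; P].toNNReal) HasLaw.id hX2 hindep hident
  have hSD := tendsto_sampleSD hX2 hindep hident
  have hMean := tendsto_sampleMean (hX2.integrable one_le_two) hindep hident
  rw [hσX, Real.sqrt_sq hσ.le] at hSD
  simp only [hv] at h2
  simp only [hc] at h1 hMean
  have hfrac : ∀ᵐ ω ∂P, Tendsto (fun n : ℕ => ((n : ℝ) / ((n : ℝ) - 1))
      / (sampleSD n (fun j => X j ω) + σ)) atTop (𝓝 (1 / (σ + σ))) := by
    filter_upwards [hSD] with ω h
    exact tendsto_natCast_div_sub_one.div (h.add_const σ) (by positivity)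
  have hcentre : ∀ᵐ ω ∂P, Tendsto (fun n : ℕ => -((n / ((n : ℝ) - 1))
      * (sampleMean n (fun j => X j ω) - c) / (sampleSD n (fun j => X j ω) + σ)))
      atTop (𝓝 0) := by
    filter_upwards [hSD, hMean] with ω h h'
    have := ((tendsto_natCast_div_sub_one.mul (h'.sub_const c)).div (h.add_const σ)
      (by positivity)).neg
    simpa using this
  have hrest : ∀ᵐ ω ∂P, Tendsto (fun n : ℕ => √(n : ℝ) * ((n : ℝ) / ((n : ℝ) - 1) - 1)
      * (σ ^ 2 / (sampleSD n (fun j => X j ω) + σ))) atTop (𝓝 0) := by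
    filter_upwards [hSD] with ω h
    have := tendsto_sqrt_mul_natCast_div_sub_one_sub_one.mul
      ((tendsto_const_nhds (x := σ ^ 2)).div (h.add_const σ) (by positivity))
    simpa using this
  have mfrac : ∀ n : ℕ, AEMeasurable (fun ω => ((n : ℝ) / ((n : ℝ) - 1))
      / (sampleSD n (fun j => X j ω) + σ)) P := fun n => by fun_prop
  have mcentre : ∀ n : ℕ, AEMeasurable (fun ω => -((n / ((n : ℝ) - 1))
      * (sampleMean n (fun j => X j ω) - c) / (sampleSD n (fun j => X j ω) + σ))) P :=
    fun n => by fun_prop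
  have mrest : ∀ n : ℕ, AEMeasurable (fun ω => √(n : ℝ) * ((n : ℝ) / ((n : ℝ) - 1) - 1)
      * (σ ^ 2 / (sampleSD n (fun j => X j ω) + σ))) P := fun n => by fun_prop
  have hA := h2.gaussianReal_mul hw0
    (tendstoInMeasure_of_tendsto_ae (fun n => (mfrac n).aestronglyMeasurable) hfrac) mfrac
  have hD := h1.mul_tendstoInMeasure_zero
    (tendstoInMeasure_of_tendsto_ae (fun n => (mcentre n).aestronglyMeasurable) hcentre) mcentre
  have hF := tendstoInMeasure_of_tendsto_ae (fun n => (mrest n).aestronglyMeasurable) hrest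
  have hDF := tendstoInMeasure_add hD hF
  have e : w / (4 * σ ^ 2) = (1 / (σ + σ)) ^ 2 * w := by field_simp; ring
  rw [e]
  refine tendstoInDistribution_of_tendstoInMeasure_sub _ _ hA ?_ fun n => by fun_prop
  simp only [Pi.zero_apply, add_zero] at hDF
  refine hDF.congr (fun n => ae_of_all _ fun ω => ?_) (ae_of_all _ fun ω => rfl)
  simp only [Pi.sub_apply]
  rw [sqrt_mul_sampleSD_sub n _ c hσ]
  ring

/-- The central limit theorem for the sample standard deviation. -/
theorem tendstoInDistribution_sampleSD (hX : MemLp (X 0) 4 P) (hindep : iIndepFun X P)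
    (hident : ∀ j, IdentDistrib (X j) (X 0) P P) :
    TendstoInDistribution
      (fun (n : ℕ) ω => √(n : ℝ) * (sampleSD n (fun j => X j ω) - √Var[X 0; P])) atTop id
      (fun _ => P)
      (gaussianReal 0 (Var[fun ω => (X 0 ω - P[X 0]) ^ 2; P] / (4 * Var[X 0; P])).toNNReal) := by
  rcases (variance_nonneg (X 0) P).eq_or_lt with h0 | hpos
  · have hz : ∀ n : ℕ, (fun _ : Ω => (0 : ℝ))
        =ᵐ[P] fun ω => √(n : ℝ) * (sampleSD n (fun j => X j ω) - √Var[X 0; P]) := by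
      intro n
      filter_upwards [sampleSD_ae_eq_zero (hX.mono_exponent (by norm_num)) hident h0.symm]
        with ω hω
      simp [hω n, ← h0]
    have hc : TendstoInDistribution (fun (_ : ℕ) (_ : Ω) => (0 : ℝ)) atTop (fun _ : Ω => (0 : ℝ))
        (fun _ => P) P := tendstoInDistribution_const aemeasurable_const
    refine (hc.of_hasLaw ?_).congr hz EventuallyEq.rfl
    refine ⟨aemeasurable_const, ?_⟩
    simp [← h0]
  · have hsq := Real.sq_sqrt hpos.le
    have := tendstoInDistribution_sampleSD_of_pos hX hindep hident rfl (Real.sqrt_pos.2 hpos)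
      hsq.symm rfl
    rwa [hsq] at this

end SampleSDCLT

section DeltaMethod

variable {ι : Type*} [Fintype ι]

theorem EuclideanSpace.norm_le_sum_abs (x : EuclideanSpace ℝ ι) : ‖x‖ ≤ ∑ i, |x i| := by
  rw [EuclideanSpace.norm_eq]
  refine Real.sqrt_le_iff.2 ⟨Finset.sum_nonneg fun i _ => abs_nonneg _, ?_⟩
  simpa using Finset.sum_sq_le_sq_sum_of_nonneg (s := Finset.univ) (f := fun i => |x i|)
    fun i _ => abs_nonneg _

/-- The first order Taylor remainder of `F` at `s`, relative to the `ℓ¹` distance from `s`. -/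
noncomputable def relativeRemainder (F : EuclideanSpace ℝ ι → ℝ) (s x : EuclideanSpace ℝ ι) : ℝ :=
  (F x - F s - inner ℝ (gradient F s) (x - s)) / ∑ i, |x i - s i|

theorem relativeRemainder_mul (F : EuclideanSpace ℝ ι → ℝ) (s x : EuclideanSpace ℝ ι) :
    (∑ i, |x i - s i|) * relativeRemainder F s x
      = F x - F s - inner ℝ (gradient F s) (x - s) := by
  rcases eq_or_ne (∑ i, |x i - s i|) 0 with h | h
  · have hx : x = s := by
      have := EuclideanSpace.norm_le_sum_abs (x - s)
      simp only [PiLp.sub_apply, h] at this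
      exact sub_eq_zero.1 (norm_le_zero_iff.1 this)
    simp [hx]
  · rw [relativeRemainder]; field_simp

theorem tendsto_relativeRemainder {F : EuclideanSpace ℝ ι → ℝ} {s : EuclideanSpace ℝ ι}
    (hF : DifferentiableAt ℝ F s) : Tendsto (relativeRemainder F s) (𝓝 s) (𝓝 0) := by
  have h := hasGradientAt_iff_isLittleO.1 hF.hasGradientAt
  refine Asymptotics.IsLittleO.tendsto_div_nhds_zero
    (h.trans_isBigO (Asymptotics.isBigO_of_le _ fun x => ?_))
  have := EuclideanSpace.norm_le_sum_abs (x - s)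
  simp only [PiLp.sub_apply] at this
  exact this.trans (le_abs_self _)

theorem measurable_relativeRemainder {F : EuclideanSpace ℝ ι → ℝ} (hF : Measurable F)
    (s : EuclideanSpace ℝ ι) : Measurable (relativeRemainder F s) := by
  unfold relativeRemainder; fun_prop

variable {Ω : Type*} {mΩ : MeasurableSpace Ω} {P : Measure Ω} [IsProbabilityMeasure P]

/-- The **delta method**, in the form that the normalised error of `F (V n)` is asymptotically
equal to its linearisation. -/
theorem tendstoInMeasure_sub_linearization {F : EuclideanSpace ℝ ι → ℝ} {s : EuclideanSpace ℝ ι}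
    (hF : DifferentiableAt ℝ F s) (hFm : Measurable F) {V : ℕ → Ω → EuclideanSpace ℝ ι}
    (hVm : ∀ n, AEMeasurable (V n) P) (hV : ∀ᵐ ω ∂P, Tendsto (fun n => V n ω) atTop (𝓝 s))
    {a : ℕ → ℝ} {ν : ι → Measure ℝ} [∀ i, IsProbabilityMeasure (ν i)]
    (hcoord : ∀ i, TendstoInDistribution (fun n ω => a n * (V n ω i - s i)) atTop id
      (fun _ => P) (ν i)) :
    TendstoInMeasure P (fun n ω => a n * (F (V n ω) - F s)
      - ∑ i, a n * (V n ω i - s i) * gradient F s i) atTop 0 := by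
  have hr : ∀ᵐ ω ∂P, Tendsto (fun n => relativeRemainder F s (V n ω)) atTop (𝓝 0) := by
    filter_upwards [hV] with ω hω
    exact (tendsto_relativeRemainder hF).comp hω
  have hrm : ∀ n, AEMeasurable (fun ω => relativeRemainder F s (V n ω)) P := fun n =>
    (measurable_relativeRemainder hFm s).comp_aemeasurable (hVm n)
  have hterm : ∀ i ∈ Finset.univ, TendstoInMeasure P
      (fun n ω => |a n * (V n ω i - s i) * relativeRemainder F s (V n ω)|) atTop 0 := fun i _ =>
    tendstoInMeasure_zero_of_norm_le ((hcoord i).mul_tendstoInMeasure_zero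
      (tendstoInMeasure_of_tendsto_ae (fun n => (hrm n).aestronglyMeasurable) hr) hrm)
      fun n ω => by simp
  refine tendstoInMeasure_zero_of_norm_le (tendstoInMeasure_finsetSum_zero _ hterm)
    fun n ω => ?_
  have e : a n * (F (V n ω) - F s) - ∑ i, a n * (V n ω i - s i) * gradient F s i
      = a n * ((∑ i, |V n ω i - s i|) * relativeRemainder F s (V n ω)) := by
    rw [relativeRemainder_mul, mul_sub _ (_ - _), PiLp.inner_apply, Finset.mul_sum]
    congr 1
    refine Finset.sum_congr rfl fun i _ => ?_
    simp only [PiLp.sub_apply, RCLike.inner_apply, conj_trivial]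
    ring
  rw [e, Finset.sum_mul, Finset.mul_sum]
  refine (norm_sum_le _ _).trans ?_
  rw [Real.norm_eq_abs, abs_of_nonneg (Finset.sum_nonneg fun i _ => abs_nonneg _)]
  exact Finset.sum_le_sum fun i _ => by simp [abs_mul, mul_assoc]

end DeltaMethod

section Subsample

variable {Ω : Type*} {mΩ : MeasurableSpace Ω} {P : Measure Ω}
  {X : ℕ → Ω → ℝ} {k : ℕ → ℕ} {c : ℝ}

theorem tendsto_atTop_of_tendsto_natCast_div (hc : 0 < c)
    (hk : Tendsto (fun N => (k N : ℝ) / N) atTop (𝓝 c)) : Tendsto k atTop atTop := by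
  rw [← tendsto_natCast_atTop_iff (R := ℝ)]
  refine (hk.pos_mul_atTop hc tendsto_natCast_atTop_atTop).congr' ?_
  filter_upwards [eventually_gt_atTop 0] with N hN
  have : (N : ℝ) ≠ 0 := by positivity
  field_simp

variable [IsProbabilityMeasure P]

/-- The central limit theorem for the sample standard deviation of `k N ∼ c N` samples. -/
theorem tendstoInDistribution_sampleSD_subsample (hX : MemLp (X 0) 4 P) (hindep : iIndepFun X P)
    (hident : ∀ j, IdentDistrib (X j) (X 0) P P) (hc : 0 < c)
    (hk : Tendsto (fun N => (k N : ℝ) / N) atTop (𝓝 c)) :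
    TendstoInDistribution
      (fun (N : ℕ) ω => √(N : ℝ) * (sampleSD (k N) (fun j => X j ω) - √Var[X 0; P])) atTop id
      (fun _ => P)
      (gaussianReal 0
        (c⁻¹ * (Var[fun ω => (X 0 ω - P[X 0]) ^ 2; P] / (4 * Var[X 0; P]))).toNNReal) := by
  have hk' := tendsto_atTop_of_tendsto_natCast_div hc hk
  have mrow : AEMeasurable (fun ω j => X j ω) P :=
    aemeasurable_pi_iff.2 fun j => (hident j).aemeasurable_fst
  have mSD : ∀ n, AEMeasurable (fun ω => sampleSD n fun j => X j ω) P := fun n =>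
    (measurable_sampleSD n).comp_aemeasurable mrow
  have h1 := (tendstoInDistribution_sampleSD hX hindep hident).comp_tendsto hk'
  have h2 : Tendsto (fun N : ℕ => √((k N : ℝ) / N)⁻¹) atTop (𝓝 √c⁻¹) :=
    (Real.continuous_sqrt.tendsto _).comp (hk.inv₀ hc.ne')
  have hτ : 0 ≤ Var[fun ω => (X 0 ω - P[X 0]) ^ 2; P] / (4 * Var[X 0; P]) :=
    div_nonneg (variance_nonneg _ _) (mul_nonneg (by norm_num) (variance_nonneg _ _))
  have h3 := h1.gaussianReal_mul hτ (tendstoInMeasure_of_tendsto_ae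
    (f := fun (N : ℕ) (_ : Ω) => √((k N : ℝ) / N)⁻¹) (fun n => by fun_prop)
    (ae_of_all _ fun _ => h2)) (fun n => by fun_prop)
  rw [Real.sq_sqrt (by positivity)] at h3
  refine h3.congr_eventually ?_ fun n => by fun_prop
  filter_upwards [hk'.eventually_gt_atTop 0] with N hN
  refine ae_of_all _ fun ω => ?_
  have hN' : √(k N : ℝ) ≠ 0 := by positivity
  simp only [inv_div]
  rw [Real.sqrt_div (by positivity)]
  field_simp

end Subsample

section VarianceConstant

variable {ι : Type*} [Fintype ι]

theorem measurable_varianceConstant (α : ℝ) (p : EuclideanSpace ℝ ι) :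
    Measurable (varianceConstant α p) := by
  unfold varianceConstant; fun_prop

theorem differentiableAt_varianceConstant {α : ℝ} {p σ : EuclideanSpace ℝ ι}
    (h : ∀ i, α * σ i + (1 - α) * inner ℝ p σ ≠ 0) :
    DifferentiableAt ℝ (varianceConstant α p) σ := by
  have hcoord : ∀ i, DifferentiableAt ℝ (fun x : EuclideanSpace ℝ ι => x i) σ := fun i => by
    fun_prop
  have hinner : DifferentiableAt ℝ (fun x : EuclideanSpace ℝ ι => inner ℝ p x) σ :=
    (differentiableAt_const p).inner ℝ differentiableAt_id
  unfold varianceConstant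
  refine hinner.mul (DifferentiableAt.fun_sum fun i _ => ?_)
  simp only [div_eq_mul_inv]
  exact ((differentiableAt_const _).mul ((hcoord i).pow 2)).mul
    ((((differentiableAt_const _).mul (hcoord i)).add
      ((differentiableAt_const _).mul hinner)).inv (h i))

theorem asympVar_eq_sum (α : ℝ) (p σ : EuclideanSpace ℝ ι) (κ : ι → ℝ) :
    asympVar α p σ κ
      = ∑ i, gradient (varianceConstant α p) σ i ^ 2 * stratumAsympVar α p σ κ i := by
  rw [asympVar, PiLp.inner_apply]
  refine Finset.sum_congr rfl fun i _ => ?_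
  simp [Matrix.mulVec_diagonal]
  ring

/-- The limit proportion of the samples that the hybrid allocation assigns to a stratum. -/
noncomputable def hybridProportion (α : ℝ) (p σ : EuclideanSpace ℝ ι) (i : ι) : ℝ :=
  p i * (((1 - α) * inner ℝ p σ + α * σ i) / inner ℝ p σ)

theorem inner_eq_sum_mul (p σ : EuclideanSpace ℝ ι) : inner ℝ p σ = ∑ i, p i * σ i := by
  rw [PiLp.inner_apply]
  exact Finset.sum_congr rfl fun i _ => by simp [mul_comm]

theorem hybridAllocation_eq {α : ℝ} {p σ : EuclideanSpace ℝ ι} (h : inner ℝ p σ ≠ 0) (N : ℝ)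
    (i : ι) : hybridAllocation α p σ N i = hybridProportion α p σ i * N := by
  rw [hybridAllocation, hybridProportion, ← inner_eq_sum_mul]
  field_simp

theorem inner_pos_of_nondegenerate {α : ℝ} {p σ : EuclideanSpace ℝ ι} (hp : ∀ i, 0 < p i)
    (hσ : ∀ i, 0 ≤ σ i) (h : ∀ i, α * σ i + (1 - α) * inner ℝ p σ ≠ 0) [Nonempty ι] :
    0 < (inner ℝ p σ : ℝ) := by
  have hnn : ∀ i ∈ Finset.univ, 0 ≤ p i * σ i := fun i _ => mul_nonneg (hp i).le (hσ i)
  rw [inner_eq_sum_mul] at *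
  refine (Finset.sum_nonneg hnn).lt_of_ne' fun h0 => ?_
  obtain ⟨i⟩ := ‹Nonempty ι›
  have hi := (Finset.sum_eq_zero_iff_of_nonneg hnn).1 h0 i (Finset.mem_univ i)
  refine h i ?_
  rw [h0, (mul_eq_zero.1 hi).resolve_left (hp i).ne']
  simp

theorem hybridProportion_pos {α : ℝ} (hα : α ∈ Set.Icc (0 : ℝ) 1) {p σ : EuclideanSpace ℝ ι}
    (hp : ∀ i, 0 < p i) (hσ : ∀ i, 0 ≤ σ i)
    (h : ∀ i, α * σ i + (1 - α) * inner ℝ p σ ≠ 0) (i : ι) : 0 < hybridProportion α p σ i := by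
  have : Nonempty ι := ⟨i⟩
  have hD := inner_pos_of_nondegenerate hp hσ h
  have h1 : 0 ≤ (1 - α) * inner ℝ p σ := mul_nonneg (by linarith [hα.2]) hD.le
  have h2 : 0 ≤ α * σ i := mul_nonneg hα.1 (hσ i)
  have h3 : 0 < (1 - α) * inner ℝ p σ + α * σ i :=
    (add_nonneg h1 h2).lt_of_ne' (by rw [add_comm]; exact h i)
  exact mul_pos (hp i) (div_pos h3 hD)

theorem tendsto_natCast_div_of_abs_sub_le {k : ℕ → ℕ} {c B : ℝ}
    (h : ∀ N : ℕ, |(k N : ℝ) - c * N| ≤ B) : Tendsto (fun N => (k N : ℝ) / N) atTop (𝓝 c) := by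
  rw [tendsto_iff_dist_tendsto_zero]
  refine squeeze_zero' (Eventually.of_forall fun _ => dist_nonneg) ?_
    (tendsto_const_div_atTop_nhds_zero_nat B)
  filter_upwards [eventually_gt_atTop 0] with N hN
  have hN' : (0 : ℝ) < N := by positivity
  rw [Real.dist_eq, div_sub' hN'.ne', abs_div, abs_of_pos hN', mul_comm (N : ℝ)]
  gcongr
  exact h N

theorem stratumAsympVar_eq {α : ℝ} {p σ : EuclideanSpace ℝ ι} {κ : ι → ℝ} {i : ι} {M : ℝ}
    (hκ : κ i = M / σ i ^ 4) :
    stratumAsympVar α p σ κ i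
      = (hybridProportion α p σ i)⁻¹ * ((M - (σ i ^ 2) ^ 2) / (4 * σ i ^ 2)) := by
  unfold stratumAsympVar hybridProportion
  split_ifs with h
  · simp [h]
  · rw [hκ]
    have : σ i ^ 2 * (M / σ i ^ 4 - 1) = (M - (σ i ^ 2) ^ 2) / σ i ^ 2 := by field_simp
    rw [this]
    simp only [div_eq_mul_inv, mul_inv, inv_inv]
    ring

end VarianceConstant

theorem lemma2 {Ω Ω' ι : Type*} [MeasurableSpace Ω] [MeasurableSpace Ω'] [Fintype ι]
    -- the model: a random vector `Y` in the domain `U`, and the quantity of interest `f(Y)`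
    (P : Measure Ω) [IsProbabilityMeasure P] {n : ℕ} (U : Set (Fin n → ℝ))
    (Y : Ω → Fin n → ℝ) (hY : Measurable Y) (hYU : ∀ᵐ ω ∂P, Y ω ∈ U)
    (f : (Fin n → ℝ) → ℝ) (hf : Measurable f)
    -- the stratification, with strata of positive probability
    (S : ι → Set (Fin n → ℝ)) (hS : IsStratification U S) (hpos : ∀ i, 0 < P (Y ⁻¹' S i))
    -- the vectors of sizes and standard deviations of the strata
    (p σ : EuclideanSpace ℝ ι) (hp : p = strataSize P Y S) (hσ : σ = strataSD P Y f S)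
    -- `Q_S ∈ L⁴` for all strata
    (hL4 : ∀ i, MemLp id 4 (stratumLaw P Y f (S i)))
    -- the hybrid parameter and the nondegeneracy condition
    (α : ℝ) (hα : α ∈ Set.Icc (0 : ℝ) 1)
    (hcond : ∀ i, α * σ i + (1 - α) * inner ℝ p σ ≠ 0)
    -- independent samples `Q i j` of `Q_S`, `S = S i`, independent across the strata as well
    (P' : Measure Ω') [IsProbabilityMeasure P'] (Q : ι → ℕ → Ω' → ℝ)
    (hQlaw : ∀ i j, HasLaw (Q i j) (stratumLaw P Y f (S i)) P')
    (hQindep : iIndepFun (fun k : ι × ℕ => Q k.1 k.2) P')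
    -- the numbers of samples: the hybrid allocation up to integer rounding
    (m : ℕ → ι → ℕ) (hm : ∀ N i, |(m N i : ℝ) - hybridAllocation α p σ N i| ≤ 1) :
    DifferentiableAt ℝ (varianceConstant α p) σ ∧
    0 ≤ asympVar α p σ (fun i => kurtosis (stratumLaw P Y f (S i))) ∧
    TendstoInDistribution
      (fun (N : ℕ) (ω : Ω') => √(N : ℝ) *
        (varianceConstant α p (WithLp.toLp 2 fun i => sampleSD (m N i) fun j => Q i j ω)
          - varianceConstant α p σ))
      atTop id (fun _ => P')
      (gaussianReal 0
        (asympVar α p σ (fun i => kurtosis (stratumLaw P Y f (S i)))).toNNReal) := by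
  classical
  set κ : ι → ℝ := fun i => kurtosis (stratumLaw P Y f (S i)) with hκ
  have hU : Nonempty ι := by
    by_contra hne
    rw [not_nonempty_iff] at hne
    have hUe : U = ∅ := by rw [← hS.iUnion_eq, Set.iUnion_of_empty]
    exact IsProbabilityMeasure.ne_zero P (by simpa [hUe] using hYU)
  have hp0 : ∀ i, 0 < p i := fun i => by
    rw [hp]; exact ENNReal.toReal_pos (hpos i).ne' (measure_ne_top _ _)
  have hσ0 : ∀ i, 0 ≤ σ i := fun i => by rw [hσ]; exact Real.sqrt_nonneg _
  have hD := inner_pos_of_nondegenerate hp0 hσ0 hcond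
  have hc := hybridProportion_pos hα hp0 hσ0 hcond
  have hk : ∀ i, Tendsto (fun N => (m N i : ℝ) / N) atTop (𝓝 (hybridProportion α p σ i)) :=
    fun i => tendsto_natCast_div_of_abs_sub_le (B := 1) fun N => by
      rw [← hybridAllocation_eq hD.ne']; exact hm N i
  have hdiff := differentiableAt_varianceConstant hcond
  have mQ : ∀ i j, AEMeasurable (Q i j) P' := fun i j => (hQlaw i j).aemeasurable
  have mRow : ∀ i, AEMeasurable (fun ω j => Q i j ω) P' := fun i => aemeasurable_pi_iff.2 (mQ i)
  have hident : ∀ i j, IdentDistrib (Q i j) (Q i 0) P' P' := fun i j =>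
    ⟨mQ i j, mQ i 0, by rw [(hQlaw i j).map_eq, (hQlaw i 0).map_eq]⟩
  have hrow : ∀ i, iIndepFun (Q i) P' := fun i =>
    hQindep.precomp (g := fun j => (i, j)) fun a b hab => by simpa using hab
  have hQ4 : ∀ i, MemLp (Q i 0) 4 P' := fun i => by
    have h := hL4 i
    rw [← (hQlaw i 0).map_eq] at h
    exact h.comp_of_map (mQ i 0)
  have hQ2 : ∀ i, MemLp (Q i 0) 2 P' := fun i => (hQ4 i).mono_exponent (by norm_num)
  have hvar : ∀ i, √Var[Q i 0; P'] = σ i := fun i => by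
    rw [(hQlaw i 0).variance_eq, hσ]; rfl
  have hvar2 : ∀ i, Var[Q i 0; P'] = σ i ^ 2 := fun i => by
    rw [← hvar, Real.sq_sqrt (variance_nonneg _ _)]
  have hτ : ∀ i, stratumAsympVar α p σ κ i = (hybridProportion α p σ i)⁻¹ *
      (Var[fun ω => (Q i 0 ω - P'[Q i 0]) ^ 2; P'] / (4 * Var[Q i 0; P'])) := fun i => by
    rw [variance_sub_integral_sq (hQ4 i), hvar2]
    refine stratumAsympVar_eq ?_
    rw [hκ, (hQlaw i 0).integral_eq]
    simp only [kurtosis]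
    congr 1
    · exact ((hQlaw i 0).integral_comp
        (f := fun x => |x - ∫ y, y ∂(stratumLaw P Y f (S i))| ^ 4)
        (Measurable.aestronglyMeasurable (by fun_prop))).symm
    · rw [hσ]; rfl
  have hτ0 : ∀ i, 0 ≤ stratumAsympVar α p σ κ i := fun i => by
    rw [hτ]
    exact mul_nonneg (inv_nonneg.2 (hc i).le) (div_nonneg (variance_nonneg _ _)
      (mul_nonneg (by norm_num) (variance_nonneg _ _)))
  have hterm0 : ∀ i, 0 ≤ gradient (varianceConstant α p) σ i ^ 2 * stratumAsympVar α p σ κ i :=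
    fun i => mul_nonneg (sq_nonneg _) (hτ0 i)
  refine ⟨hdiff, ?_, ?_⟩
  · rw [asympVar_eq_sum]
    exact Finset.sum_nonneg fun i _ => hterm0 i
  have hstratum : ∀ i, TendstoInDistribution
      (fun (N : ℕ) ω => √(N : ℝ) * (sampleSD (m N i) (fun j => Q i j ω) - σ i)) atTop id
      (fun _ => P') (gaussianReal 0 (stratumAsympVar α p σ κ i).toNNReal) := fun i => by
    have h := tendstoInDistribution_sampleSD_subsample (hQ4 i) (hrow i) (hident i) (hc i) (hk i)
    rwa [← hτ, hvar] at h
  have hlin := tendstoInDistribution_sum_gaussianReal hterm0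
    (fun i => (hstratum i).gaussianReal_mul (hτ0 i)
      (tendstoInMeasure_of_tendsto_ae (f := fun (_ : ℕ) (_ : Ω') =>
        gradient (varianceConstant α p) σ i) (fun n => by fun_prop)
        (ae_of_all _ fun _ => tendsto_const_nhds)) (fun n => by fun_prop))
    fun N => (iIndepFun_curry mQ hQindep).comp
      (fun i x => √(N : ℝ) * (sampleSD (m N i) x - σ i) * gradient (varianceConstant α p) σ i)
      fun i => by
        have := measurable_sampleSD (m N i)
        fun_prop
  rw [← asympVar_eq_sum] at hlin
  have mV : ∀ N : ℕ, AEMeasurable (fun ω => (WithLp.toLp 2 fun i =>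
      sampleSD (m N i) fun j => Q i j ω : EuclideanSpace ℝ ι)) P' := fun N =>
    (PiLp.continuous_toLp 2 _).measurable.comp_aemeasurable (aemeasurable_pi_iff.2 fun i =>
      (measurable_sampleSD (m N i)).comp_aemeasurable (mRow i))
  have hV : ∀ᵐ ω ∂P', Tendsto (fun N : ℕ => (WithLp.toLp 2 fun i =>
      sampleSD (m N i) fun j => Q i j ω : EuclideanSpace ℝ ι)) atTop (𝓝 σ) := by
    filter_upwards [ae_all_iff.2 fun i => tendsto_sampleSD (hQ2 i) (hrow i) (hident i)]
      with ω hω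
    refine ((PiLp.continuous_toLp 2 _).tendsto σ.ofLp).comp (tendsto_pi_nhds.2 fun i => ?_)
    rw [← hvar]
    exact (hω i).comp (tendsto_atTop_of_tendsto_natCast_div (hc i) (hk i))
  have hC := measurable_varianceConstant α p
  exact tendstoInDistribution_of_tendstoInMeasure_sub _ _ hlin
    (tendstoInMeasure_sub_linearization hdiff hC mV hV hstratum)
    fun N => ((hC.comp_aemeasurable (mV N)).sub_const _).const_mul _
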